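/- An overpartition of $n$ is a partition of $n$ in which the first occurrence of any part may be overlined. For a partition $\mu$, let $\omega(\mu)$ be the number of ones in $\mu$; the crank $cr(\mu)$ is the largest part of $\mu$ if $\omega(\mu)=0$ (and $0$ for the empty partition), and otherwise the number of parts of $\mu$ exceeding $\omega(\mu)$, minus $\omega(\mu)$. For $d\ge1$ and an overpartition $\lambda$, let $\lambda'$ be the partition obtained by dividing by $d$ the non-overlined parts of $\lambda$ that are divisible by $d$; the $d$th residual crank of $\lambda$ is $cr(\lambda')$. Let $\overline{M[d]}(m,n)$ be the number of overpartitions of $n$ with $d$th residual crank $m$, with the usual crank convention for the partition $(1)$: an overpartition with $\lambda'=(1)$ contributes $1$ to $\overline{M[d]}(1,n)$, $1$ to $\overline{M[d]}(-1,n)$, $-1$ to $\overline{M[d]}(0,n)$, and nothing for other $m$. Let $$\overline{M[d]}_k^+(n)=\sum_{m\ge1}m^k\,\overline{M[d]}(m,n),$$ that is, the sum of the $k$th powers of the $d$th residual cranks over the overpartitions $\lambda$ of $n$ with positive residual crank, where $\lambda$ with $\lambda'=(1)$ is counted with crank $1$. Let $A_k(t)$ be the Eulerian polynomials: $A_0(t)=1$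 and $A_k(t)=\sum_{i=0}^{k-1}A_{k,i}t^i$ for $k\ge1$, where $A_{0,0}=1$, $A_{0,i}=0$ for $i\ne0$, and $A_{k,i}=(i+1)A_{k-1,i}+(k-i)A_{k-1,i-1}$ for $k\ge 1$ and $i\ge0$, with $A_{k-1,-1}=0$. Then for all integers $d\ge1$ and $k\ge0$, as formal power series in $q$ (the sum over $n$ on the right converging coefficientwise), $$\sum_{n\ge0}\overline{M[d]}_k^+(n)\,q^n=\frac{(-q;q)_\infty}{(q;q)_\infty}\sum_{n\ge1}(-1)^{n+1}\frac{q^{d\,n(n+1)/2}A_k(q^{dn})}{(1-q^{dn})^k},\qquad (a;q)_\infty=\prod_{i\ge0}(1-aq^i).$$ -/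

import Mathlib

open scoped PowerSeries.WithPiTopology

/-- An overpartition of `n`: a partition of `n` together with a set of (distinct) part sizes, namely
those whose first occurrence is overlined. -/
@[ext]
structure Overpartition (n : ℕ) where
  /-- the underlying partition, in which overlines are forgotten -/
  toPartition : n.Partition
  /-- the part sizes whose first occurrence is overlined -/
  overlined : Finset ℕ
  overlined_subset : overlined ⊆ toPartition.parts.toFinset

namespace Overpartition

/-- Overpartitions as dependent pairs; used for finiteness only. -/
def equivSigma (n : ℕ) :
    (Σ p : n.Partition, {s : Finset ℕ // s ∈ p.parts.toFinset.powerset}) ≃ Overpartition n where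
  toFun x := ⟨x.1, x.2.1, Finset.mem_powerset.1 x.2.2⟩
  invFun y := ⟨y.toPartition, y.overlined, Finset.mem_powerset.2 y.overlined_subset⟩
  left_inv _ := rfl
  right_inv _ := rfl

instance (n : ℕ) : Fintype (Overpartition n) := Fintype.ofEquiv _ (equivSigma n)

variable {n : ℕ}

/-- The multiset of non-overlined parts: one copy of each overlined part size is removed. -/
def nonOverlined (l : Overpartition n) : Multiset ℕ :=
  l.toPartition.parts - l.overlined.val

/-- The partition obtained from the non-overlined parts divisible by `d` by dividing them all
by `d`. -/
def residual (d : ℕ) (l : Overpartition n) : Multiset ℕ :=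
  (l.nonOverlined.filter (fun a => d ∣ a)).map (fun a => a / d)

end Overpartition

/-- The crank of a partition, given by its multiset of parts. If `1` is not a part it is the largest
part (`0` for the empty partition); otherwise it is the number of parts exceeding the number `w`
of ones, minus `w`. -/
def crank (s : Multiset ℕ) : ℤ :=
  if s.count 1 = 0 then (s.sup : ℤ)
  else ((s.filter (fun a => s.count 1 < a)).card : ℤ) - (s.count 1 : ℤ)

/-- The contribution of the partition `s` to the crank counts at `m`: it is `1` if `s` has crank `m`
and `0` otherwise, with the usual exception of the partition `(1)` of the integer `1`, for which
`M(1,1) = M(-1,1) = 1`, `M(0,1) = -1` and `M(m,1) = 0` for all other `m`. -/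
def crankWeight (s : Multiset ℕ) (m : ℤ) : ℤ :=
  if s = {1} then (if m = 1 ∨ m = -1 then 1 else if m = 0 then -1 else 0)
  else if crank s = m then 1 else 0

/-- The number of overpartitions of `n` with `d`th residual crank `m`, under the usual convention
for the partition `(1)`. -/
def residualCrankCount (d : ℕ) (m : ℤ) (n : ℕ) : ℤ :=
  ∑ l : Overpartition n, crankWeight (l.residual d) m

/-- The `k`th positive moment of the `d`th residual crank on overpartitions of `n`, that is
`∑_{m ≥ 1} m ^ k * M[d](m, n)`. The terms with `m > n` vanish, see
`residualCrankCount_eq_zero`. -/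
def residualCrankPosMoment (d k n : ℕ) : ℤ :=
  ∑ m ∈ Finset.Icc 1 n, (m : ℤ) ^ k * residualCrankCount d (m : ℤ) n

theorem abs_crank_le (s : Multiset ℕ) : |crank s| ≤ (s.sum : ℤ) := by
  have hsup : s.sup ≤ s.sum := Multiset.sup_le.2 fun b hb => Multiset.le_sum_of_mem hb
  unfold crank
  split_ifs with h
  · rw [abs_of_nonneg (by positivity)]
    exact_mod_cast hsup
  · have h1 : s.count 1 ≤ s.sum := by
      have h2 : Multiset.replicate (s.count 1) 1 ≤ s := Multiset.le_count_iff_replicate_le.1 le_rfl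
      obtain ⟨u, hu⟩ := Multiset.le_iff_exists_add.1 h2
      have h3 := congrArg Multiset.sum hu
      simp only [Multiset.sum_add, Multiset.sum_replicate, smul_eq_mul, mul_one] at h3
      omega
    have h4 : (s.filter (fun a => s.count 1 < a)).card ≤ s.sum := by
      obtain ⟨u, hu⟩ := Multiset.le_iff_exists_add.1
        (Multiset.filter_le (fun a => s.count 1 < a) s)
      have h5 : (s.filter (fun a => s.count 1 < a)).card • 1
          ≤ (s.filter (fun a => s.count 1 < a)).sum :=
        Multiset.card_nsmul_le_sum fun x hx => by
          have := (Multiset.mem_filter.1 hx).2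
          omega
      have h3 := congrArg Multiset.sum hu
      simp only [Multiset.sum_add] at h3
      simp only [smul_eq_mul, mul_one] at h5
      omega
    rw [abs_le]
    omega

theorem Overpartition.sum_residual_le {n : ℕ} (d : ℕ) (l : Overpartition n) :
    (l.residual d).sum ≤ n := by
  have h0 : l.nonOverlined.filter (fun a => d ∣ a) ≤ l.toPartition.parts :=
    (Multiset.filter_le _ _).trans (Multiset.sub_le_self _ _)
  obtain ⟨u, hu⟩ := Multiset.le_iff_exists_add.1 h0
  have h3 := congrArg Multiset.sum hu
  rw [Multiset.sum_add, l.toPartition.parts_sum] at h3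
  have h1 : (l.residual d).sum ≤ (l.nonOverlined.filter (fun a => d ∣ a)).sum := by
    have := Multiset.sum_map_le_sum_map (s := l.nonOverlined.filter (fun a => d ∣ a))
      (fun a => a / d) (fun a => a) (fun a _ => Nat.div_le_self a d)
    simpa [Overpartition.residual] using this
  omega

theorem residualCrankCount_eq_zero (d : ℕ) (m : ℤ) (n : ℕ) (h : (n : ℤ) < |m|) :
    residualCrankCount d m n = 0 := by
  refine Finset.sum_eq_zero fun l _ => ?_
  have h1 : ((l.residual d).sum : ℤ) ≤ n := by exact_mod_cast l.sum_residual_le d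
  unfold crankWeight
  split_ifs with h2 h3 h4 h5
  · rw [h2] at h1
    rcases h3 with rfl | rfl <;> simp at h h1 <;> omega
  · subst h4
    simp at h
    omega
  · rfl
  · have := abs_crank_le (l.residual d)
    rw [h5] at this
    omega
  · rfl

/-- The positive moment as a sum over the overpartitions of `n` with positive residual crank, where
the partition `(1)` counts with crank `1`. -/
theorem residualCrankPosMoment_eq_sum (d k n : ℕ) :
    residualCrankPosMoment d k n = ∑ l : Overpartition n,
      (if l.residual d = {1} then 1
        else if 0 < crank (l.residual d) then crank (l.residual d) ^ k else 0) := by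
  unfold residualCrankPosMoment residualCrankCount
  simp_rw [Finset.mul_sum]
  rw [Finset.sum_comm]
  refine Finset.sum_congr rfl fun l _ => ?_
  have h1 : ((l.residual d).sum : ℤ) ≤ n := by exact_mod_cast l.sum_residual_le d
  have h2 := (abs_le.1 (abs_crank_le (l.residual d))).2
  unfold crankWeight
  split_ifs with h h3
  · rw [h] at h1
    rw [Finset.sum_eq_single 1]
    · simp
    · intro b hb hb1
      have := (Finset.mem_Icc.1 hb).1
      simp [hb1]
      omega
    · intro h4
      simp at h1 h4
      omega
  · obtain ⟨c, hc⟩ := Int.eq_ofNat_of_zero_le h3.le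
    rw [Finset.sum_eq_single c]
    · simp [hc]
    · intro b hb hb1
      rw [if_neg (by omega), mul_zero]
    · intro h4
      exact absurd (Finset.mem_Icc.2 ⟨by omega, by omega⟩) h4
  · refine Finset.sum_eq_zero fun b hb => ?_
    have := (Finset.mem_Icc.1 hb).1
    rw [if_neg (by omega), mul_zero]

/-- The Eulerian numbers: `A_{0,0} = 1`, `A_{0,i} = 0` for `i ≠ 0`, and
`A_{k,i} = (i+1) A_{k-1,i} + (k-i) A_{k-1,i-1}` for `k ≥ 1`, where `A_{k-1,-1} = 0`. -/
def eulerianNumber : ℕ → ℕ → ℤ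
  | 0, 0 => 1
  | 0, _ + 1 => 0
  | k + 1, 0 => eulerianNumber k 0
  | k + 1, i + 1 =>
    ((i : ℤ) + 2) * eulerianNumber k (i + 1) + ((k : ℤ) - (i : ℤ)) * eulerianNumber k i

/-- The Eulerian polynomial `A_k(t) = ∑_{i=0}^{k-1} A_{k,i} t^i` for `k ≥ 1`, and `A_0(t) = 1`. -/
noncomputable def eulerianPolynomial : ℕ → Polynomial ℤ
  | 0 => 1
  | k + 1 => ∑ i ∈ Finset.range (k + 1),
      Polynomial.C (eulerianNumber (k + 1) i) * Polynomial.X ^ i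

/-- The `q`-Pochhammer symbol `(a; q)_∞ = ∏_{i ≥ 0} (1 - a q^i)` for formal power series `a`, `q`;
the product converges coefficientwise. -/
noncomputable def qPochhammer (a q : PowerSeries ℤ) : PowerSeries ℤ :=
  ∏' i : ℕ, (1 - a * q ^ i)

theorem multipliable_qPochhammer (c : ℤ) :
    Multipliable fun i : ℕ =>
      (1 - (PowerSeries.C c * PowerSeries.X) * PowerSeries.X ^ i : PowerSeries ℤ) := by
  simp_rw [sub_eq_add_neg]
  apply PowerSeries.WithPiTopology.multipliable_one_add_of_tendsto_order_atTop_nhds_top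
  refine ENat.tendsto_nhds_top_iff_natCast_lt.mpr fun n => Filter.eventually_atTop.mpr ⟨n, ?_⟩
  intro m hm
  have h : ((m + 1 : ℕ) : ℕ∞)
      ≤ (-((PowerSeries.C c * PowerSeries.X) * PowerSeries.X ^ m) : PowerSeries ℤ).order := by
    refine PowerSeries.le_order _ _ fun i hi => ?_
    have hi' : i < m + 1 := by exact_mod_cast hi
    rw [mul_assoc, ← pow_succ', map_neg, PowerSeries.coeff_C_mul, PowerSeries.coeff_X_pow,
      if_neg (by omega), mul_zero, neg_zero]
  refine lt_of_lt_of_le ?_ h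
  exact_mod_cast Nat.lt_succ_of_le hm

theorem constantCoeff_qPochhammer_X :
    PowerSeries.constantCoeff (qPochhammer PowerSeries.X PowerSeries.X) = 1 := by
  have h := multipliable_qPochhammer 1
  simp only [map_one, one_mul] at h
  unfold qPochhammer
  rw [h.map_tprod _ (PowerSeries.WithPiTopology.continuous_constantCoeff ℤ)]
  simp

/-- The inverse of a formal power series with constant coefficient `1`. -/
noncomputable def invOne (f : PowerSeries ℤ) : PowerSeries ℤ :=
  PowerSeries.invOfUnit f 1

theorem mul_invOne (f : PowerSeries ℤ) (h : PowerSeries.constantCoeff f = 1) :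
    f * invOne f = 1 :=
  PowerSeries.mul_invOfUnit f 1 (by simpa using h)

/-- The generating series `(-q; q)_∞ / (q; q)_∞` of overpartitions. -/
noncomputable def overpartitionSeries : PowerSeries ℤ :=
  qPochhammer (-PowerSeries.X) PowerSeries.X * invOne (qPochhammer PowerSeries.X PowerSeries.X)

/-- The `n`th term
`(-1)^(n+1) q^(d (n^2+n)/2) A_k(q^(d n)) / (1 - q^(d n))^k` of the series. -/
noncomputable def momentTerm (d k n : ℕ) : PowerSeries ℤ :=
  (-1) ^ (n + 1) * PowerSeries.X ^ (d * ((n ^ 2 + n) / 2))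
    * Polynomial.aeval (PowerSeries.X ^ (d * n) : PowerSeries ℤ) (eulerianPolynomial k)
    * invOne ((1 - PowerSeries.X ^ (d * n)) ^ k)

/-!
A weight `f` on partitions has the generating series `partitionSeries f = ∑ f(s) q^|s|`. Removing a
part (`partitionSeries_erase`), separating the parts with a given property
(`partitionSeries_filter_mul`) and dividing all parts by `d` (`partitionSeries_map_div`) translate
into operations on these series, and the enumerations below combine these operations. Write
`P = 1 / (q; q)_∞` for the series of all partitions and `(q)_j = (q; q)_j`.

*Cranks of ordinary partitions.* Let `m ≥ 1`. A partition of crank `m` with `w ≥ 1` ones consists of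
the ones, parts in `[2, w]`, and `m + w` parts exceeding `w`; so it contributes to
`(1 - q) q^(w + (w + 1)(m + w)) / ((q)_w (q)_(m + w))`. For `w = 0` the same expression counts the
partitions without ones and with largest part `m`, and for `m = 1` it is the monomial `q`, which is
exactly the exceptional contribution of the partition `(1)`. Hence the crank `m` has the series
`(1 - q) q^m F_2(m)`, where `F_j(m) = ∑_w q^(w^2 + w m + j w) / ((q)_w (q)_(m + w))` is
`rectangleSeries j m`. Removing the last factor of one of the two denominators gives
`F_j(m) - F_(j+1)(m) = q^(m+j+1) F_(j+1)(m+1)` and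
`F_(j+1)(m) = F_j(m+1) - q^(m+1) F_(j+1)(m+1)`. From these, `F_0(m)` does not depend on `m` and
equals its limit `P`; then `F_1(m) = P ∑_r (-1)^r q^(r m + r(r+1)/2)` by iteration; and
`(1 - q) F_2(m) = F_1(m) - q F_1(m + 1)`. So the crank `m` has the series
`P ∑_{n ≥ 1} (-1)^(n-1) q^(n(n-1)/2 + n m) (1 - q^n)` (`partitionSeries_crankWeight_eq_tsum`).

*Overpartitions.* An overpartition is a partition into distinct parts together with an arbitrary
partition, whose parts are either divisible by `d` or not. In the product
`(-q; q)_∞ P` only the factor `P(q^d)` for the parts divisible by `d` is changed by prescribing the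
residual crank, and the previous formula says that it is multiplied by the sum over `n` taken at
`q^d` (`mk_residualCrankCount`).

*Moments.* Multiply by `m^k`, sum over `m ≥ 1` and interchange the two sums. The inner sum is
evaluated by `∑_{m ≥ 1} m^k x^m = x A_k(x) / (1 - x)^(k + 1)` at `x = q^(d n)`
(`powerSumSeries_mul`).
-/

/-! ### Generating series of weighted partitions -/

/-- The partitions of `n`, as a finite set of multisets of positive integers. -/
def partitionParts (n : ℕ) : Finset (Multiset ℕ) :=
  Finset.univ.image fun p : n.Partition => p.parts

theorem mem_partitionParts {n : ℕ} {s : Multiset ℕ} :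
    s ∈ partitionParts n ↔ s.sum = n ∧ ∀ i ∈ s, 0 < i := by
  simp only [partitionParts, Finset.mem_image, Finset.mem_univ, true_and]
  constructor
  · rintro ⟨p, rfl⟩
    exact ⟨p.parts_sum, fun i hi => p.parts_pos hi⟩
  · rintro ⟨h, h'⟩
    exact ⟨⟨s, fun {i} hi => h' i hi, h⟩, rfl⟩

/-- The generating series `∑ f(s) q^|s|` over all partitions `s`, for a weight `f`. -/
noncomputable def partitionSeries (f : Multiset ℕ → ℤ) : PowerSeries ℤ :=
  PowerSeries.mk fun n => ∑ s ∈ partitionParts n, f s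

theorem coeff_partitionSeries (f : Multiset ℕ → ℤ) (n : ℕ) :
    PowerSeries.coeff n (partitionSeries f) = ∑ s ∈ partitionParts n, f s :=
  PowerSeries.coeff_mk _ _

theorem partitionSeries_congr {f g : Multiset ℕ → ℤ}
    (h : ∀ s : Multiset ℕ, (∀ i ∈ s, 0 < i) → f s = g s) :
    partitionSeries f = partitionSeries g := by
  ext n
  simp only [coeff_partitionSeries]
  exact Finset.sum_congr rfl fun s hs => h s (mem_partitionParts.1 hs).2

theorem partitionSeries_add (f g : Multiset ℕ → ℤ) :
    partitionSeries (fun s => f s + g s) = partitionSeries f + partitionSeries g := by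
  ext n
  simp [coeff_partitionSeries, Finset.sum_add_distrib]

theorem partitionSeries_eq_zero : partitionSeries (fun s => if s = 0 then 1 else 0) = 1 := by
  ext n
  rw [coeff_partitionSeries, Finset.sum_ite_eq', PowerSeries.coeff_one]
  simp [mem_partitionParts, eq_comm]

/-- Two weights that agree on all partitions of integers below `n` have congruent series. -/
theorem X_pow_dvd_partitionSeries_sub {f g : Multiset ℕ → ℤ} {n : ℕ}
    (h : ∀ s : Multiset ℕ, (∀ i ∈ s, 0 < i) → s.sum < n → f s = g s) :
    PowerSeries.X ^ n ∣ partitionSeries f - partitionSeries g := by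
  rw [PowerSeries.X_pow_dvd_iff]
  intro j hj
  rw [map_sub, sub_eq_zero, coeff_partitionSeries, coeff_partitionSeries]
  refine Finset.sum_congr rfl fun s hs => ?_
  obtain ⟨h1, h2⟩ := mem_partitionParts.1 hs
  exact h s h2 (by omega)

/-- Inserting a part `a` multiplies the series by `q ^ a`. -/
theorem partitionSeries_erase (f : Multiset ℕ → ℤ) {a : ℕ} (ha : 0 < a) :
    partitionSeries (fun s => if a ∈ s then f (s.erase a) else 0) =
      PowerSeries.X ^ a * partitionSeries f := by
  ext n
  rw [PowerSeries.coeff_X_pow_mul', coeff_partitionSeries, ← Finset.sum_filter]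
  split_ifs with h
  · rw [coeff_partitionSeries]
    refine Finset.sum_nbij' (fun s => s.erase a) (fun s => a ::ₘ s) ?_ ?_ ?_ ?_ ?_
    · intro s hs
      obtain ⟨hs, has⟩ := Finset.mem_filter.1 hs
      obtain ⟨h1, h2⟩ := mem_partitionParts.1 hs
      have h3 := Multiset.sum_erase has
      exact mem_partitionParts.2 ⟨by omega, fun i hi => h2 i (Multiset.mem_of_mem_erase hi)⟩
    · intro s hs
      obtain ⟨h1, h2⟩ := mem_partitionParts.1 hs
      refine Finset.mem_filter.2 ⟨mem_partitionParts.2 ⟨?_, ?_⟩, Multiset.mem_cons_self _ _⟩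
      · rw [Multiset.sum_cons]
        omega
      · intro i hi
        rcases Multiset.mem_cons.1 hi with rfl | hi
        exacts [ha, h2 i hi]
    · intro s hs
      exact Multiset.cons_erase (Finset.mem_filter.1 hs).2
    · intro s _
      exact Multiset.erase_cons_head _ _
    · intro s _
      rfl
  · refine Finset.sum_eq_zero fun s hs => ?_
    obtain ⟨hs, has⟩ := Finset.mem_filter.1 hs
    have := Multiset.le_sum_of_mem has
    have := (mem_partitionParts.1 hs).1
    omega

/-- The product of two series is a sum over pairs of partitions. -/
theorem coeff_partitionSeries_mul (f g : Multiset ℕ → ℤ) (n : ℕ) :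
    PowerSeries.coeff n (partitionSeries f * partitionSeries g) =
      ∑ x ∈ (Finset.HasAntidiagonal.antidiagonal n).biUnion
        (fun p => partitionParts p.1 ×ˢ partitionParts p.2), f x.1 * g x.2 := by
  rw [PowerSeries.coeff_mul, Finset.sum_biUnion]
  · refine Finset.sum_congr rfl fun p _ => ?_
    rw [coeff_partitionSeries, coeff_partitionSeries, Finset.sum_mul_sum, Finset.sum_product]
  · intro p _ q _ hpq
    refine Finset.disjoint_left.2 fun x hx hx' => hpq ?_
    simp only [Finset.mem_product, mem_partitionParts] at hx hx'
    exact Prod.ext (hx.1.1.symm.trans hx'.1.1) (hx.2.1.symm.trans hx'.2.1)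

theorem mem_biUnion_partitionParts {n : ℕ} {x : Multiset ℕ × Multiset ℕ} :
    x ∈ (Finset.HasAntidiagonal.antidiagonal n).biUnion
        (fun p => partitionParts p.1 ×ˢ partitionParts p.2) ↔
      x.1.sum + x.2.sum = n ∧ (∀ i ∈ x.1, 0 < i) ∧ ∀ i ∈ x.2, 0 < i := by
  simp only [Finset.mem_biUnion, Finset.HasAntidiagonal.mem_antidiagonal, Finset.mem_product,
    mem_partitionParts]
  constructor
  · rintro ⟨p, h, h1, h2⟩
    exact ⟨by omega, h1.2, h2.2⟩
  · rintro ⟨h, h1, h2⟩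
    exact ⟨(x.1.sum, x.2.sum), h, ⟨rfl, h1⟩, rfl, h2⟩

/-- A weight that is a product of a weight of the parts with `P` and a weight of the others gives
a product of series. -/
theorem partitionSeries_filter_mul (P : ℕ → Prop) [DecidablePred P] (f g : Multiset ℕ → ℤ) :
    partitionSeries (fun s => f (s.filter P) * g (s.filter fun i => ¬ P i)) =
      partitionSeries (fun s => if ∀ i ∈ s, P i then f s else 0) *
        partitionSeries (fun s => if ∀ i ∈ s, ¬ P i then g s else 0) := by
  ext n
  have hsum (s : Multiset ℕ) : (s.filter P).sum + (s.filter fun i => ¬ P i).sum = s.sum := by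
    rw [← Multiset.sum_add, Multiset.filter_add_not]
  rw [coeff_partitionSeries_mul, coeff_partitionSeries]
  simp_rw [ite_zero_mul_ite_zero]
  rw [← Finset.sum_filter]
  refine Finset.sum_nbij' (fun s => (s.filter P, s.filter fun i => ¬ P i))
    (fun x => x.1 + x.2) ?_ ?_ ?_ ?_ ?_
  · intro s hs
    obtain ⟨h1, h2⟩ := mem_partitionParts.1 hs
    rw [Finset.mem_filter, mem_biUnion_partitionParts]
    refine ⟨⟨by simpa [hsum] using h1, ?_, ?_⟩, ?_, ?_⟩
    · exact fun i hi => h2 i (Multiset.mem_filter.1 hi).1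
    · exact fun i hi => h2 i (Multiset.mem_filter.1 hi).1
    · exact fun i hi => (Multiset.mem_filter.1 hi).2
    · exact fun i hi => (Multiset.mem_filter.1 hi).2
  · intro x hx
    rw [Finset.mem_filter, mem_biUnion_partitionParts] at hx
    obtain ⟨⟨h1, h2, h3⟩, -⟩ := hx
    refine mem_partitionParts.2 ⟨by rw [Multiset.sum_add, h1], fun i hi => ?_⟩
    rcases Multiset.mem_add.1 hi with hi | hi
    exacts [h2 i hi, h3 i hi]
  · intro s _
    exact Multiset.filter_add_not _ _
  · rintro ⟨a, b⟩ hx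
    obtain ⟨-, h1, h2⟩ := Finset.mem_filter.1 hx
    have h3 : a.filter P = a := Multiset.filter_eq_self.2 h1
    have h4 : b.filter P = 0 := Multiset.filter_eq_nil.2 h2
    have h5 : a.filter (fun i => ¬ P i) = 0 :=
      Multiset.filter_eq_nil.2 fun i hi => not_not.2 (h1 i hi)
    have h6 : b.filter (fun i => ¬ P i) = b := Multiset.filter_eq_self.2 h2
    simp only [Multiset.filter_add, h3, h4, h5, h6, add_zero, zero_add]
  · intro s _
    rfl

/-- Multiplying all parts by `d` replaces `q` by `q ^ d`. -/
theorem partitionSeries_map_div (f : Multiset ℕ → ℤ) {d : ℕ} (hd : d ≠ 0) :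
    partitionSeries (fun s => if ∀ i ∈ s, d ∣ i then f (s.map (· / d)) else 0) =
      PowerSeries.expand d hd (partitionSeries f) := by
  have hinv (s : Multiset ℕ) (h : ∀ i ∈ s, d ∣ i) : (s.map (· / d)).map (d * ·) = s := by
    rw [Multiset.map_map]
    conv_rhs => rw [← Multiset.map_id s]
    exact Multiset.map_congr rfl fun i hi => Nat.mul_div_cancel' (h i hi)
  ext n
  rw [coeff_partitionSeries, ← Finset.sum_filter]
  by_cases h : d ∣ n
  · obtain ⟨n, rfl⟩ := h
    rw [PowerSeries.coeff_expand_mul, coeff_partitionSeries]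
    refine Finset.sum_nbij' (fun s => s.map (· / d)) (fun s => s.map (d * ·)) ?_ ?_ ?_ ?_ ?_
    · intro s hs
      obtain ⟨hs, hdvd⟩ := Finset.mem_filter.1 hs
      obtain ⟨h1, h2⟩ := mem_partitionParts.1 hs
      refine mem_partitionParts.2 ⟨?_, ?_⟩
      · have := congrArg Multiset.sum (hinv s hdvd)
        rw [Multiset.sum_map_mul_left, Multiset.map_id', h1] at this
        exact Nat.eq_of_mul_eq_mul_left (Nat.pos_of_ne_zero hd) this
      · intro i hi
        obtain ⟨j, hj, rfl⟩ := Multiset.mem_map.1 hi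
        exact Nat.div_pos (Nat.le_of_dvd (h2 j hj) (hdvd j hj)) (Nat.pos_of_ne_zero hd)
    · intro s hs
      obtain ⟨h1, h2⟩ := mem_partitionParts.1 hs
      refine Finset.mem_filter.2 ⟨mem_partitionParts.2 ⟨?_, ?_⟩, ?_⟩
      · rw [Multiset.sum_map_mul_left, Multiset.map_id', h1]
      · intro i hi
        obtain ⟨j, hj, rfl⟩ := Multiset.mem_map.1 hi
        exact Nat.mul_pos (Nat.pos_of_ne_zero hd) (h2 j hj)
      · intro i hi
        obtain ⟨j, hj, rfl⟩ := Multiset.mem_map.1 hi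
        exact dvd_mul_right _ _
    · intro s hs
      exact hinv s (Finset.mem_filter.1 hs).2
    · intro s _
      simp [Multiset.map_map, Nat.mul_div_cancel_left _ (Nat.pos_of_ne_zero hd)]
    · intro s _
      rfl
  · rw [PowerSeries.coeff_expand_of_not_dvd d hd _ h]
    refine Finset.sum_eq_zero fun s hs => absurd ?_ h
    obtain ⟨hs, hdvd⟩ := Finset.mem_filter.1 hs
    rw [← (mem_partitionParts.1 hs).1]
    exact Multiset.dvd_sum hdvd

/-- Sorting partitions by the value of a statistic `c`. -/
theorem hasSum_partitionSeries_fiber (f : Multiset ℕ → ℤ) (c : Multiset ℕ → ℕ) :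
    HasSum (fun w => partitionSeries fun s => if c s = w then f s else 0) (partitionSeries f) := by
  rw [PowerSeries.WithPiTopology.hasSum_iff_hasSum_coeff]
  intro n
  simp only [coeff_partitionSeries]
  refine hasSum_sum fun s _ => ?_
  simpa [eq_comm] using hasSum_ite_eq (c s) (f s)

/-- Overpartitions are pairs of a partition into distinct parts (the overlined ones) and an
arbitrary partition (the other parts). -/
theorem sum_overpartition_nonOverlined (f : Multiset ℕ → ℤ) (n : ℕ) :
    ∑ l : Overpartition n, f l.nonOverlined =
      PowerSeries.coeff n
        (partitionSeries (fun s => if s.Nodup then 1 else 0) * partitionSeries f) := by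
  rw [coeff_partitionSeries_mul]
  simp_rw [ite_mul, one_mul, zero_mul]
  rw [← Finset.sum_filter]
  have hle (l : Overpartition n) : l.overlined.val ≤ l.toPartition.parts := by
    rw [Multiset.le_iff_subset l.overlined.nodup]
    intro i hi
    exact Multiset.mem_toFinset.1 (l.overlined_subset hi)
  refine Finset.sum_bij (fun l _ => (l.overlined.val, l.nonOverlined)) ?_ ?_ ?_ ?_
  · intro l _
    rw [Finset.mem_filter, mem_biUnion_partitionParts]
    refine ⟨⟨?_, ?_, ?_⟩, l.overlined.nodup⟩
    · rw [← Multiset.sum_add, Overpartition.nonOverlined, add_tsub_cancel_of_le (hle l),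
        l.toPartition.parts_sum]
    · exact fun i hi => l.toPartition.parts_pos (Multiset.mem_of_le (hle l) hi)
    · exact fun i hi =>
        l.toPartition.parts_pos (Multiset.mem_of_le (Multiset.sub_le_self _ _) hi)
  · intro l _ l' _ h
    obtain ⟨h1, h2⟩ := Prod.mk.inj h
    refine Overpartition.ext (Nat.Partition.ext ?_) (Finset.val_inj.1 h1)
    rw [← add_tsub_cancel_of_le (hle l), ← add_tsub_cancel_of_le (hle l')]
    exact congrArg₂ (· + ·) h1 h2
  · rintro ⟨b, a⟩ hx
    rw [Finset.mem_filter, mem_biUnion_partitionParts] at hx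
    obtain ⟨⟨h1, h2, h3⟩, h4⟩ := hx
    refine ⟨⟨⟨b + a, ?_, by rw [Multiset.sum_add, h1]⟩, ⟨b, h4⟩, ?_⟩, Finset.mem_univ _, ?_⟩
    · intro i hi
      rcases Multiset.mem_add.1 hi with hi | hi
      exacts [h2 i hi, h3 i hi]
    · intro i hi
      exact Multiset.mem_toFinset.2 (Multiset.mem_add.2 (Or.inl hi))
    · simp [Overpartition.nonOverlined]
  · intro l _
    rfl

/-! ### Congruences modulo powers of the variable -/

/-- Power series that are congruent modulo every power of `X` are equal. -/
theorem eq_of_forall_X_pow_dvd_sub {f g : PowerSeries ℤ}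
    (h : ∀ n : ℕ, PowerSeries.X ^ n ∣ f - g) : f = g := by
  ext n
  rw [← sub_eq_zero, ← map_sub]
  exact PowerSeries.X_pow_dvd_iff.1 (h (n + 1)) n (Nat.lt_succ_self n)

/-- A sequence of power series congruent to `g` modulo growing powers of `X` tends to `g`. -/
theorem tendsto_of_X_pow_dvd_sub {f : ℕ → PowerSeries ℤ} {g : PowerSeries ℤ}
    (h : ∀ n : ℕ, PowerSeries.X ^ n ∣ f n - g) : Filter.Tendsto f Filter.atTop (nhds g) := by
  rw [PowerSeries.WithPiTopology.tendsto_iff_coeff_tendsto]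
  refine fun d => tendsto_atTop_of_eventually_const (i₀ := d + 1) fun n hn => ?_
  rw [← sub_eq_zero, ← map_sub]
  exact PowerSeries.X_pow_dvd_iff.1 (h n) d (by omega)

theorem summable_of_X_pow_dvd {ι : Type*} {f : ι → PowerSeries ℤ} (g : ι → ℕ)
    (hg : ∀ n, {i | g i ≤ n}.Finite) (h : ∀ i, PowerSeries.X ^ g i ∣ f i) : Summable f := by
  rw [PowerSeries.WithPiTopology.summable_iff_summable_coeff]
  refine fun d => summable_of_hasFiniteSupport ((hg d).subset fun i hi => ?_)
  by_contra h1
  exact hi (PowerSeries.X_pow_dvd_iff.1 (h i) d (not_le.1 h1))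

theorem summable_nat_of_X_pow_dvd {f : ℕ → PowerSeries ℤ} (h : ∀ i, PowerSeries.X ^ i ∣ f i) :
    Summable f :=
  summable_of_X_pow_dvd id Set.finite_Iic h

theorem X_pow_dvd_tsum {ι : Type*} {f : ι → PowerSeries ℤ} {n : ℕ} (hf : Summable f)
    (h : ∀ i, PowerSeries.X ^ n ∣ f i) : PowerSeries.X ^ n ∣ ∑' i, f i := by
  rw [PowerSeries.X_pow_dvd_iff]
  intro d hd
  rw [hf.map_tsum _ (PowerSeries.WithPiTopology.continuous_coeff ℤ d)]
  simp [fun i => PowerSeries.X_pow_dvd_iff.1 (h i) d hd]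

/-! ### Partitions with bounded parts, with distinct parts, and with a given number of parts -/

/-- The generating series of all partitions. -/
noncomputable def allPartitions : PowerSeries ℤ := partitionSeries fun _ => 1

/-- The generating series of the partitions with all parts at most `m`. -/
noncomputable def partsAtMost (m : ℕ) : PowerSeries ℤ :=
  partitionSeries fun s => if ∀ i ∈ s, i ≤ m then 1 else 0

theorem forall_mem_iff_erase {s : Multiset ℕ} {a : ℕ} (h : a ∈ s) (P : ℕ → Prop) :
    (∀ i ∈ s, P i) ↔ P a ∧ ∀ i ∈ s.erase a, P i := by
  conv_lhs => rw [← Multiset.cons_erase h]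
  simp

theorem partsAtMost_zero : partsAtMost 0 = 1 := by
  rw [← partitionSeries_eq_zero]
  refine partitionSeries_congr fun s hs => if_congr ?_ rfl rfl
  refine ⟨fun h => Multiset.eq_zero_of_forall_notMem fun i hi => ?_, fun h => by simp [h]⟩
  have := h i hi
  have := hs i hi
  omega

/-- A partition with parts at most `m + 1` either has parts at most `m` or loses a part `m + 1`. -/
theorem partsAtMost_succ (m : ℕ) :
    (1 - PowerSeries.X ^ (m + 1)) * partsAtMost (m + 1) = partsAtMost m := by
  rw [sub_mul, one_mul, sub_eq_iff_eq_add]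
  unfold partsAtMost
  rw [← partitionSeries_erase _ m.succ_pos, ← partitionSeries_add]
  refine partitionSeries_congr fun s _ => ?_
  by_cases h : m + 1 ∈ s
  · have h1 : ¬ ∀ i ∈ s, i ≤ m := fun h2 => by have := h2 _ h; omega
    simp [h, h1, forall_mem_iff_erase h (fun i => i ≤ m + 1)]
  · have h1 : (∀ i ∈ s, i ≤ m + 1) ↔ ∀ i ∈ s, i ≤ m := by
      refine forall₂_congr fun i hi => ⟨fun h2 => ?_, fun h2 => by omega⟩
      have : i ≠ m + 1 := fun h3 => h (h3 ▸ hi)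
      omega
    simp [h, h1]

theorem X_pow_dvd_partsAtMost_sub (m : ℕ) :
    PowerSeries.X ^ m ∣ partsAtMost m - allPartitions := by
  refine X_pow_dvd_partitionSeries_sub fun s _ h => if_pos fun i hi => ?_
  have := Multiset.le_sum_of_mem hi
  omega

theorem prod_mul_partsAtMost (m : ℕ) :
    (∏ i ∈ Finset.range m, (1 - PowerSeries.X * PowerSeries.X ^ i : PowerSeries ℤ)) *
      partsAtMost m = 1 := by
  induction m with
  | zero => simp [partsAtMost_zero]
  | succ m ih => rw [Finset.prod_range_succ, mul_assoc, ← pow_succ', partsAtMost_succ, ih]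

/-- Euler's product: `1 / (q; q)_∞` generates all partitions. -/
theorem qPochhammer_mul_allPartitions :
    qPochhammer PowerSeries.X PowerSeries.X * allPartitions = 1 := by
  have h := multipliable_qPochhammer 1
  simp only [map_one, one_mul] at h
  have h1 := h.hasProd.tendsto_prod_nat.mul (tendsto_of_X_pow_dvd_sub X_pow_dvd_partsAtMost_sub)
  simp only [prod_mul_partsAtMost] at h1
  exact tendsto_nhds_unique h1 tendsto_const_nhds

theorem invOne_eq_of_mul_eq_one {f g : PowerSeries ℤ} (h : f * g = 1)
    (hf : PowerSeries.constantCoeff f = 1) : invOne f = g := by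
  calc invOne f = f * g * invOne f := by rw [h, one_mul]
    _ = f * invOne f * g := by ring
    _ = g := by rw [mul_invOne f hf, one_mul]

/-- The generating series of the partitions into distinct parts. -/
noncomputable def distinctPartitions : PowerSeries ℤ :=
  partitionSeries fun s => if s.Nodup then 1 else 0

theorem prod_one_add_eq_partitionSeries (m : ℕ) :
    ∏ i ∈ Finset.range m, (1 - -PowerSeries.X * PowerSeries.X ^ i : PowerSeries ℤ) =
      partitionSeries fun s => if s.Nodup ∧ ∀ i ∈ s, i ≤ m then 1 else 0 := by
  induction m with
  | zero =>
    rw [Finset.prod_range_zero, ← partitionSeries_eq_zero]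
    refine partitionSeries_congr fun s hs => if_congr ?_ rfl rfl
    refine ⟨fun h => by simp [h], fun h => Multiset.eq_zero_of_forall_notMem fun i hi => ?_⟩
    have := h.2 i hi
    have := hs i hi
    omega
  | succ m ih =>
    rw [Finset.prod_range_succ, ih, neg_mul, sub_neg_eq_add, mul_add, mul_one, ← pow_succ',
      mul_comm _ (PowerSeries.X ^ _), ← partitionSeries_erase _ m.succ_pos, ← partitionSeries_add]
    refine partitionSeries_congr fun s _ => ?_
    by_cases h : m + 1 ∈ s
    · have h1 : ¬ ∀ i ∈ s, i ≤ m := fun h2 => by have := h2 _ h; omega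
      have h2 : (s.Nodup ∧ ∀ i ∈ s, i ≤ m + 1) ↔
          (s.erase (m + 1)).Nodup ∧ ∀ i ∈ s.erase (m + 1), i ≤ m := by
        conv_lhs => rw [← Multiset.cons_erase h]
        rw [Multiset.nodup_cons]
        constructor
        · rintro ⟨⟨h3, h4⟩, h5⟩
          refine ⟨h4, fun i hi => ?_⟩
          have h6 := h5 i (Multiset.mem_cons_of_mem hi)
          have : i ≠ m + 1 := fun h7 => h3 (h7 ▸ hi)
          omega
        · rintro ⟨h3, h4⟩
          refine ⟨⟨fun h5 => ?_, h3⟩, fun i hi => ?_⟩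
          · have := h4 _ h5
            omega
          · rcases Multiset.mem_cons.1 hi with rfl | hi
            · exact le_rfl
            · have := h4 i hi
              omega
      simp [h, h1, h2]
    · have h1 : (∀ i ∈ s, i ≤ m + 1) ↔ ∀ i ∈ s, i ≤ m := by
        refine forall₂_congr fun i hi => ⟨fun h2 => ?_, fun h2 => by omega⟩
        have : i ≠ m + 1 := fun h3 => h (h3 ▸ hi)
        omega
      simp [h, h1]

theorem qPochhammer_neg_X : qPochhammer (-PowerSeries.X) PowerSeries.X = distinctPartitions := by
  have h := multipliable_qPochhammer (-1)
  simp only [map_neg, map_one, neg_one_mul] at h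
  have h1 := h.hasProd.tendsto_prod_nat
  simp only [prod_one_add_eq_partitionSeries] at h1
  refine tendsto_nhds_unique h1 (tendsto_of_X_pow_dvd_sub fun n => ?_)
  refine X_pow_dvd_partitionSeries_sub fun s _ h => if_congr ?_ rfl rfl
  refine and_iff_left fun i hi => ?_
  have := Multiset.le_sum_of_mem hi
  omega

theorem overpartitionSeries_eq : overpartitionSeries = distinctPartitions * allPartitions := by
  rw [overpartitionSeries, qPochhammer_neg_X,
    invOne_eq_of_mul_eq_one qPochhammer_mul_allPartitions constantCoeff_qPochhammer_X]

/-- The partitions with `j` parts, all exceeding `w`: subtracting `w + 1` from every part and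
conjugating gives the partitions with all parts at most `j`. -/
theorem partitionSeries_card_eq (j w : ℕ) :
    (partitionSeries fun s => if s.card = j ∧ ∀ i ∈ s, w < i then 1 else 0) =
      PowerSeries.X ^ (j * (w + 1)) * partsAtMost j := by
  induction j generalizing w with
  | zero =>
    rw [zero_mul, pow_zero, one_mul, partsAtMost_zero, ← partitionSeries_eq_zero]
    refine partitionSeries_congr fun s _ => if_congr ?_ rfl rfl
    rw [Multiset.card_eq_zero, and_iff_left_iff_imp]
    rintro rfl
    simp
  | succ j ih =>
    -- Both sides satisfy `f w = f (w + 1) + X ^ (w + 1) * g w` for the same `g`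
    -- (split off one part `w + 1` if there is one), and tend to `0` as `w` grows.
    let B (w : ℕ) := partitionSeries fun s => if s.card = j + 1 ∧ ∀ i ∈ s, w < i then 1 else 0
    let R (w : ℕ) : PowerSeries ℤ := PowerSeries.X ^ ((j + 1) * (w + 1)) * partsAtMost (j + 1)
    have hB (w : ℕ) : B w = B (w + 1) +
        PowerSeries.X ^ (w + 1) * (PowerSeries.X ^ (j * (w + 1)) * partsAtMost j) := by
      rw [← ih w, ← partitionSeries_erase _ w.succ_pos, ← partitionSeries_add]
      refine partitionSeries_congr fun s _ => ?_
      by_cases h : w + 1 ∈ s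
      · have h1 : ¬ ∀ i ∈ s, w + 1 < i := fun h2 => by have := h2 _ h; omega
        have h2 := Multiset.card_erase_add_one h
        have h3 : s.card = j + 1 ↔ (s.erase (w + 1)).card = j := by omega
        simp [h, h1, h3, forall_mem_iff_erase h (fun i => w < i)]
      · have h1 : (∀ i ∈ s, w < i) ↔ ∀ i ∈ s, w + 1 < i := by
          refine forall₂_congr fun i hi => ⟨fun h2 => ?_, fun h2 => by omega⟩
          have : i ≠ w + 1 := fun h3 => h (h3 ▸ hi)
          omega
        simp [h, h1]
    have hR (w : ℕ) : R w = R (w + 1) +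
        PowerSeries.X ^ (w + 1) * (PowerSeries.X ^ (j * (w + 1)) * partsAtMost j) := by
      simp only [R]
      rw [← partsAtMost_succ j]
      ring
    have hsub (v : ℕ) : B w - R w = B (w + v) - R (w + v) := by
      induction v with
      | zero => rfl
      | succ v ihv => rw [ihv, hB (w + v), hR (w + v), ← add_assoc w v 1]; ring
    change B w = R w
    refine eq_of_forall_X_pow_dvd_sub fun n => ?_
    rw [hsub n]
    refine dvd_sub ?_ (dvd_mul_of_dvd_left (pow_dvd_pow _ (by nlinarith)) _)
    have h0 : (partitionSeries fun _ => 0) = 0 := by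
      ext n
      simp [coeff_partitionSeries]
    rw [← sub_zero (B _), ← h0]
    refine X_pow_dvd_partitionSeries_sub fun s _ hs => if_neg ?_
    rintro ⟨h1, h2⟩
    obtain ⟨a, ha⟩ := Multiset.card_pos_iff_exists_mem.1 (h1.symm ▸ j.succ_pos : 0 < s.card)
    have := h2 a ha
    have := Multiset.le_sum_of_mem ha
    omega

/-! ### Durfee rectangles and a partial theta series -/

/-- The term `q^(w^2 + w m + j w) / ((q; q)_w (q; q)_(m + w))`. -/
noncomputable def rectangleTerm (j m w : ℕ) : PowerSeries ℤ :=
  PowerSeries.X ^ (w * w + w * m + j * w) * partsAtMost w * partsAtMost (m + w)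

/-- The series `∑_w q^(w^2 + w m + j w) / ((q; q)_w (q; q)_(m + w))`. For `j = 0` this sorts the
partitions by their Durfee rectangle of size `w × (m + w)`. -/
noncomputable def rectangleSeries (j m : ℕ) : PowerSeries ℤ := ∑' w, rectangleTerm j m w

theorem summable_rectangleTerm (j m : ℕ) : Summable (rectangleTerm j m) := by
  refine summable_nat_of_X_pow_dvd fun w => ?_
  refine dvd_mul_of_dvd_left (dvd_mul_of_dvd_left (pow_dvd_pow _ ?_) _) _
  nlinarith [Nat.zero_le (w * m), Nat.zero_le (j * w), Nat.le_mul_self w]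

/-- Uses `1 / (q; q)_w = (1 - q ^ (w + 1)) / (q; q)_(w + 1)` for the first factor of the
denominators. -/
theorem rectangleSeries_sub_succ (j m : ℕ) :
    rectangleSeries j m - rectangleSeries (j + 1) m =
      PowerSeries.X ^ (m + j + 1) * rectangleSeries (j + 1) (m + 1) := by
  have h := (summable_rectangleTerm j m).sub (summable_rectangleTerm (j + 1) m)
  rw [rectangleSeries, rectangleSeries, ← (summable_rectangleTerm j m).tsum_sub
    (summable_rectangleTerm (j + 1) m), h.tsum_eq_zero_add, rectangleSeries,
    ← (summable_rectangleTerm (j + 1) (m + 1)).tsum_mul_left]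
  have h0 : rectangleTerm j m 0 - rectangleTerm (j + 1) m 0 = 0 := by simp [rectangleTerm]
  rw [h0, zero_add]
  refine tsum_congr fun w => ?_
  unfold rectangleTerm
  rw [← partsAtMost_succ w, show m + 1 + w = m + (w + 1) by ring]
  ring

/-- Uses `1 / (q; q)_(m + w) = (1 - q ^ (m + w + 1)) / (q; q)_(m + w + 1)` for the second factor
of the denominators. -/
theorem rectangleSeries_succ_left (j m : ℕ) :
    rectangleSeries (j + 1) m = rectangleSeries j (m + 1) -
      PowerSeries.X ^ (m + 1) * rectangleSeries (j + 1) (m + 1) := by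
  rw [rectangleSeries, rectangleSeries, rectangleSeries,
    ← (summable_rectangleTerm (j + 1) (m + 1)).tsum_mul_left,
    ← (summable_rectangleTerm j (m + 1)).tsum_sub
      ((summable_rectangleTerm (j + 1) (m + 1)).mul_left _)]
  refine tsum_congr fun w => ?_
  unfold rectangleTerm
  rw [← partsAtMost_succ (m + w), show m + 1 + w = m + w + 1 by ring]
  ring

theorem rectangleSeries_zero (m : ℕ) : rectangleSeries 0 m = allPartitions := by
  -- The series does not depend on `m`, and its limit as `m` grows comes from the term `w = 0`.
  have hstep (m : ℕ) : rectangleSeries 0 m = rectangleSeries 0 (m + 1) := by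
    linear_combination rectangleSeries_sub_succ 0 m + rectangleSeries_succ_left 0 m
  have hshift (n : ℕ) : rectangleSeries 0 m = rectangleSeries 0 (m + n) := by
    induction n with
    | zero => rfl
    | succ n ih => rw [ih, hstep, add_assoc]
  refine eq_of_forall_X_pow_dvd_sub fun n => ?_
  rw [hshift n, rectangleSeries, (summable_rectangleTerm 0 (m + n)).tsum_eq_zero_add, add_comm,
    add_sub_assoc]
  refine dvd_add (X_pow_dvd_tsum ((summable_nat_add_iff 1).2 (summable_rectangleTerm 0 _))
    fun w => ?_) ?_
  · refine dvd_mul_of_dvd_left (dvd_mul_of_dvd_left (pow_dvd_pow _ ?_) _) _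
    nlinarith [Nat.zero_le (w * m), Nat.zero_le (w * n)]
  · have h := X_pow_dvd_partsAtMost_sub (m + n)
    simp only [rectangleTerm, partsAtMost_zero, zero_mul, mul_zero, add_zero, pow_zero, one_mul]
    exact (pow_dvd_pow _ (by omega)).trans h

theorem triangle_succ (r : ℕ) : ((r + 1) ^ 2 + (r + 1)) / 2 = (r ^ 2 + r) / 2 + (r + 1) := by
  rw [show (r + 1) ^ 2 + (r + 1) = r ^ 2 + r + (r + 1) * 2 by ring,
    Nat.add_mul_div_right _ _ two_pos]

/-- The term `(-1)^r q^(r m + r (r + 1) / 2)` of a partial theta series. -/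
noncomputable def thetaTerm (m r : ℕ) : PowerSeries ℤ :=
  (-1) ^ r * PowerSeries.X ^ (r * m + (r ^ 2 + r) / 2)

/-- The partial theta series `∑_r (-1)^r q^(r m + r (r + 1) / 2)`. -/
noncomputable def thetaSeries (m : ℕ) : PowerSeries ℤ := ∑' r, thetaTerm m r

theorem le_triangle (r : ℕ) : r ≤ (r ^ 2 + r) / 2 := by
  rw [Nat.le_div_iff_mul_le two_pos]
  nlinarith [Nat.le_mul_self r]

theorem summable_thetaTerm (m : ℕ) : Summable (thetaTerm m) := by
  refine summable_nat_of_X_pow_dvd fun r => dvd_mul_of_dvd_right (pow_dvd_pow _ ?_) _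
  exact (le_triangle r).trans (Nat.le_add_left _ _)

theorem thetaSeries_eq (m : ℕ) :
    thetaSeries m = 1 - PowerSeries.X ^ (m + 1) * thetaSeries (m + 1) := by
  rw [thetaSeries, (summable_thetaTerm m).tsum_eq_zero_add, thetaSeries,
    ← (summable_thetaTerm (m + 1)).tsum_mul_left, sub_eq_add_neg, ← tsum_neg]
  congr 1
  · simp [thetaTerm]
  · refine tsum_congr fun r => ?_
    unfold thetaTerm
    rw [triangle_succ]
    ring

theorem rectangleSeries_one (m : ℕ) : rectangleSeries 1 m = allPartitions * thetaSeries m := by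
  -- Both sides solve `f m = P - X ^ (m + 1) * f (m + 1)`.
  have hstep (m : ℕ) : rectangleSeries 1 m - allPartitions * thetaSeries m =
      -PowerSeries.X ^ (m + 1) *
        (rectangleSeries 1 (m + 1) - allPartitions * thetaSeries (m + 1)) := by
    have h := rectangleSeries_succ_left 0 m
    rw [rectangleSeries_zero, zero_add] at h
    rw [h, thetaSeries_eq m]
    ring
  have hdvd (n : ℕ) (m : ℕ) :
      PowerSeries.X ^ n ∣ rectangleSeries 1 m - allPartitions * thetaSeries m := by
    induction n generalizing m with
    | zero => simp
    | succ n ih =>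
      rw [hstep, pow_succ']
      refine mul_dvd_mul ?_ (ih _)
      rw [dvd_neg]
      exact dvd_pow_self _ m.succ_ne_zero
  exact eq_of_forall_X_pow_dvd_sub fun n => hdvd n m

theorem one_sub_X_mul_rectangleSeries_two (m : ℕ) :
    (1 - PowerSeries.X) * rectangleSeries 2 m =
      allPartitions * (thetaSeries m - PowerSeries.X * thetaSeries (m + 1)) := by
  have h1 := rectangleSeries_sub_succ 1 m
  have h2 := rectangleSeries_succ_left 1 m
  rw [rectangleSeries_one] at h1 h2
  linear_combination -h1 - PowerSeries.X * h2

/-! ### Partitions of given positive crank -/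

theorem partitionSeries_two_le {m : ℕ} (hm : 1 ≤ m) :
    (partitionSeries fun s => if ∀ i ∈ s, 2 ≤ i ∧ i ≤ m then 1 else 0) =
      (1 - PowerSeries.X) * partsAtMost m := by
  rw [sub_mul, one_mul, eq_sub_iff_add_eq]
  conv_lhs => rw [← pow_one (PowerSeries.X : PowerSeries ℤ)]
  unfold partsAtMost
  rw [← partitionSeries_erase _ one_pos, ← partitionSeries_add]
  refine partitionSeries_congr fun s hs => ?_
  by_cases h : 1 ∈ s
  · have h1 : ¬ ∀ i ∈ s, 2 ≤ i ∧ i ≤ m := fun h2 => by have := h2 _ h; omega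
    simp [h, h1, forall_mem_iff_erase h (fun i => i ≤ m), hm]
  · have h1 : (∀ i ∈ s, 2 ≤ i ∧ i ≤ m) ↔ ∀ i ∈ s, i ≤ m := by
      refine forall₂_congr fun i hi => and_iff_right ?_
      have : i ≠ 1 := fun h3 => h (h3 ▸ hi)
      have := hs i hi
      omega
    simp [h, h1]

/-- Partitions with all parts at most `m`, exactly `w` of them ones. -/
theorem partitionSeries_count_one {m : ℕ} (hm : 1 ≤ m) (w : ℕ) :
    (partitionSeries fun s => if ∀ i ∈ s, i ≤ m then (if s.count 1 = w then 1 else 0) else 0) =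
      PowerSeries.X ^ w * ((1 - PowerSeries.X) * partsAtMost m) := by
  induction w with
  | zero =>
    rw [pow_zero, one_mul, ← partitionSeries_two_le hm]
    refine partitionSeries_congr fun s hs => ?_
    rw [← ite_and]
    refine if_congr ?_ rfl rfl
    rw [Multiset.count_eq_zero]
    constructor
    · rintro ⟨h1, h2⟩ i hi
      have : i ≠ 1 := fun h3 => h2 (h3 ▸ hi)
      have := hs i hi
      exact ⟨by omega, h1 i hi⟩
    · refine fun h => ⟨fun i hi => (h i hi).2, fun h1 => ?_⟩
      have := h 1 h1
      omega
  | succ w ih =>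
    rw [pow_succ', mul_assoc, ← ih]
    conv_rhs => rw [← pow_one (PowerSeries.X : PowerSeries ℤ)]
    rw [← partitionSeries_erase _ one_pos]
    refine partitionSeries_congr fun s _ => ?_
    by_cases h : 1 ∈ s
    · have h1 : s.count 1 = (s.erase 1).count 1 + 1 := by
        conv_lhs => rw [← Multiset.cons_erase h, Multiset.count_cons_self]
      rw [if_pos h]
      simp only [forall_mem_iff_erase h (fun i => i ≤ m), hm, true_and, h1,
        Nat.add_right_cancel_iff]
    · rw [if_neg h, Multiset.count_eq_zero_of_notMem h]
      simp

/-- For `w ≥ 1`: partitions with `w` ones and `m + w` parts exceeding `w`. -/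
theorem partitionSeries_ones_and_large {m w : ℕ} (hw : 1 ≤ w) :
    (partitionSeries fun s =>
      if s.count 1 = w ∧ (s.filter fun i => w < i).card = m + w then 1 else 0) =
      (1 - PowerSeries.X) * PowerSeries.X ^ m * rectangleTerm 2 m w := by
  have h := partitionSeries_filter_mul (fun i => i ≤ w) (fun s => if s.count 1 = w then 1 else 0)
    (fun s => if s.card = m + w then 1 else 0)
  rw [partitionSeries_count_one hw w] at h
  have h1 : (partitionSeries fun s => if ∀ i ∈ s, ¬ i ≤ w then
      (if s.card = m + w then 1 else 0) else 0) =
      PowerSeries.X ^ ((m + w) * (w + 1)) * partsAtMost (m + w) := by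
    rw [← partitionSeries_card_eq]
    refine partitionSeries_congr fun s _ => ?_
    rw [← ite_and]
    refine if_congr ?_ rfl rfl
    simp only [not_le]
    exact and_comm
  rw [h1] at h
  unfold rectangleTerm
  trans PowerSeries.X ^ w * ((1 - PowerSeries.X) * partsAtMost w) *
    (PowerSeries.X ^ ((m + w) * (w + 1)) * partsAtMost (m + w))
  · rw [← h]
    refine partitionSeries_congr fun s _ => ?_
    rw [ite_zero_mul_ite_zero, mul_one]
    refine if_congr ?_ rfl rfl
    rw [Multiset.count_filter_of_pos (p := fun i => i ≤ w) hw]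
    simp only [not_le]
  · ring

/-- For `m ≥ 1`: partitions without ones and with largest part `m`; for `m = 1`, the
partition `(1)` instead. -/
theorem partitionSeries_largest {m : ℕ} (hm : 1 ≤ m) :
    (partitionSeries fun s => if m ∈ s then
      (if ∀ i ∈ s.erase m, 2 ≤ i ∧ i ≤ m then 1 else 0) else 0) =
      (1 - PowerSeries.X) * PowerSeries.X ^ m * rectangleTerm 2 m 0 := by
  rw [partitionSeries_erase (fun s => if ∀ i ∈ s, 2 ≤ i ∧ i ≤ m then 1 else 0) hm,
    partitionSeries_two_le hm]
  simp only [rectangleTerm, partsAtMost_zero, add_zero]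
  ring

theorem crankWeight_eq_of_count_one_eq_zero {m : ℕ} (hm : 1 ≤ m) {s : Multiset ℕ}
    (hs : ∀ i ∈ s, 0 < i) (h1 : s ≠ {1}) (h : s.count 1 = 0) :
    crankWeight s m = if m ∈ s then
      (if ∀ i ∈ s.erase m, 2 ≤ i ∧ i ≤ m then 1 else 0) else 0 := by
  rw [crankWeight, if_neg h1, crank, if_pos h, ← ite_and]
  refine if_congr ?_ rfl rfl
  rw [Nat.cast_inj]
  have h2 : ∀ i ∈ s, 2 ≤ i := fun i hi => by
    have : i ≠ 1 := fun h3 => Multiset.count_eq_zero.1 h (h3 ▸ hi)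
    have := hs i hi
    omega
  constructor
  · intro h3
    refine ⟨?_, fun i hi => ?_⟩
    · have h4 : s.toFinset.Nonempty := by
        rw [Finset.nonempty_iff_ne_empty, Ne, Multiset.toFinset_eq_empty]
        rintro rfl
        simp at h3
        omega
      obtain ⟨i, hi, h5⟩ := Finset.exists_max_image s.toFinset id h4
      rw [Multiset.mem_toFinset] at hi
      have h6 : s.sup ≤ i := Multiset.sup_le.2 fun b hb => h5 b (Multiset.mem_toFinset.2 hb)
      have h7 : i ≤ s.sup := Multiset.le_sup hi
      have h8 : i = m := by omega
      exact h8 ▸ hi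
    · have hi := Multiset.mem_of_mem_erase hi
      exact ⟨h2 i hi, h3 ▸ Multiset.le_sup hi⟩
  · rintro ⟨h3, h4⟩
    refine le_antisymm (Multiset.sup_le.2 fun b hb => ?_) (Multiset.le_sup h3)
    rw [← Multiset.cons_erase h3, Multiset.mem_cons] at hb
    rcases hb with rfl | hb
    exacts [le_rfl, (h4 b hb).2]

/-- Partitions of positive crank `m`, sorted by the number `w` of ones. The partition `(1)`, which
counts with crank `1`, is sorted under `w = 0`. -/
theorem partitionSeries_crankWeight {m : ℕ} (hm : 1 ≤ m) :
    (partitionSeries fun s => crankWeight s m) =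
      (1 - PowerSeries.X) * PowerSeries.X ^ m * rectangleSeries 2 m := by
  refine HasSum.unique (hasSum_partitionSeries_fiber _ fun s => if s = {1} then 0 else s.count 1) ?_
  convert! (summable_rectangleTerm 2 m).hasSum.mul_left ((1 - PowerSeries.X) * PowerSeries.X ^ m)
    using 1
  funext w
  rcases Nat.eq_zero_or_pos w with rfl | hw
  · rw [← partitionSeries_largest hm]
    refine partitionSeries_congr fun s hs => ?_
    by_cases h1 : s = {1}
    · subst h1
      rcases eq_or_ne m 1 with rfl | h2
      · simp [crankWeight]
      · have h3 : (m : ℤ) ≠ -1 := by omega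
        have h4 : m ≠ 0 := by omega
        simp [crankWeight, h2, h3, h4]
    · by_cases h : s.count 1 = 0
      · rw [← crankWeight_eq_of_count_one_eq_zero hm hs h1 h]
        simp [h1, h]
      · rw [if_neg (by simpa [h1] using h)]
        have h2 : 1 ∈ s := Multiset.count_ne_zero.1 h
        by_cases h3 : m ∈ s
        · rw [if_pos h3, if_neg]
          intro h4
          by_cases h5 : m = 1
          · subst h5
            refine h1 ?_
            rw [← Multiset.cons_erase h3]
            have : s.erase 1 = 0 := Multiset.eq_zero_of_forall_notMem fun i hi => by
              have := h4 i hi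
              omega
            rw [this]
            rfl
          · have := h4 1 ((Multiset.mem_erase_of_ne (Ne.symm h5)).2 h2)
            omega
        · rw [if_neg h3]
  · rw [← partitionSeries_ones_and_large hw]
    refine partitionSeries_congr fun s _ => ?_
    by_cases h1 : s = {1}
    · subst h1
      rw [if_pos rfl, if_neg (by omega), if_neg]
      rintro ⟨h2, h3⟩
      have h4 : w = 1 := by simpa using h2.symm
      subst h4
      simp [Multiset.filter_singleton] at h3
    · rw [if_neg h1, crankWeight, if_neg h1, crank, ← ite_and]
      refine if_congr (and_congr_right fun h => ?_) rfl rfl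
      rw [h, if_neg (by omega)]
      omega

/-- The term `(-1)^(n - 1) q^(n (n - 1) / 2 + n m) (1 - q^n)` of the crank series, with
`n = r + 1`. -/
noncomputable def crankTerm (m r : ℕ) : PowerSeries ℤ :=
  (-1) ^ r * PowerSeries.X ^ ((r + 1) * m + (r ^ 2 + r) / 2) * (1 - PowerSeries.X ^ (r + 1))

theorem hasSum_crankTerm (m : ℕ) :
    HasSum (crankTerm m)
      (PowerSeries.X ^ m * (thetaSeries m - PowerSeries.X * thetaSeries (m + 1))) := by
  refine (((summable_thetaTerm m).hasSum.sub
    ((summable_thetaTerm (m + 1)).hasSum.mul_left PowerSeries.X)).mul_left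
    (PowerSeries.X ^ m)).congr_fun ?_
  intro r
  simp only [crankTerm, thetaTerm]
  ring

theorem partitionSeries_crankWeight_eq_tsum {m : ℕ} (hm : 1 ≤ m) :
    (partitionSeries fun s => crankWeight s m) = allPartitions * ∑' r, crankTerm m r := by
  rw [partitionSeries_crankWeight hm, (hasSum_crankTerm m).tsum_eq]
  linear_combination PowerSeries.X ^ m * one_sub_X_mul_rectangleSeries_two m

/-! ### Residual cranks of overpartitions -/

theorem HasSum.powerSeries_expand {ι : Type*} {f : ι → PowerSeries ℤ} {g : PowerSeries ℤ}
    (h : HasSum f g) {d : ℕ} (hd : d ≠ 0) :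
    HasSum (fun i => PowerSeries.expand d hd (f i)) (PowerSeries.expand d hd g) := by
  rw [PowerSeries.WithPiTopology.hasSum_iff_hasSum_coeff] at h ⊢
  intro n
  by_cases hn : d ∣ n
  · obtain ⟨n, rfl⟩ := hn
    simpa only [PowerSeries.coeff_expand_mul] using h n
  · simp only [PowerSeries.coeff_expand_of_not_dvd d hd _ hn]
    exact hasSum_zero

/-- Prescribing the residual crank only affects the factor for the non-overlined parts divisible
by `d`, which is `allPartitions` at `q ^ d`; it gets multiplied by the sum of the `crankTerm`s at
`q ^ d`. -/
theorem mk_residualCrankCount {d m : ℕ} (hd : d ≠ 0) (hm : 1 ≤ m) :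
    PowerSeries.mk (residualCrankCount d m) =
      overpartitionSeries * PowerSeries.expand d hd (∑' r, crankTerm m r) := by
  have h1 : (PowerSeries.mk (residualCrankCount d m)) = distinctPartitions *
      partitionSeries (fun s => crankWeight ((s.filter (d ∣ ·)).map (· / d)) m) := by
    ext n
    rw [PowerSeries.coeff_mk, distinctPartitions, ← sum_overpartition_nonOverlined]
    rfl
  have h2 := partitionSeries_filter_mul (d ∣ ·) (fun s => crankWeight (s.map (· / d)) m) fun _ => 1
  have h3 := partitionSeries_filter_mul (d ∣ ·) (fun _ => 1) fun _ => 1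
  rw [partitionSeries_map_div (fun s => crankWeight s m) hd,
    partitionSeries_crankWeight_eq_tsum hm, map_mul] at h2
  rw [partitionSeries_map_div (fun _ => 1) hd] at h3
  simp only [mul_one] at h2 h3
  rw [h1, h2, overpartitionSeries_eq]
  change allPartitions = PowerSeries.expand d hd allPartitions * _ at h3
  conv_rhs => rw [h3]
  ring

/-! ### Eulerian polynomials -/

theorem eulerianNumber_eq_zero {k i : ℕ} (hk : 1 ≤ k) (h : k ≤ i) : eulerianNumber k i = 0 := by
  induction k generalizing i with
  | zero => omega
  | succ k ih =>
    obtain ⟨i, rfl⟩ : ∃ j, i = j + 1 := ⟨i - 1, by omega⟩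
    rw [eulerianNumber]
    rcases Nat.eq_zero_or_pos k with rfl | hk
    · rcases Nat.eq_zero_or_pos i with rfl | hi
      · simp [eulerianNumber]
      · obtain ⟨i, rfl⟩ : ∃ j, i = j + 1 := ⟨i - 1, by omega⟩
        simp [eulerianNumber]
    · rw [ih hk (by omega), mul_zero, zero_add]
      rcases Nat.eq_or_lt_of_le (Nat.le_of_succ_le_succ h) with rfl | h1
      · rw [sub_self, zero_mul]
      · rw [ih hk h1.le, mul_zero]

theorem coe_eulerianPolynomial (k : ℕ) :
    (eulerianPolynomial k : PowerSeries ℤ) = PowerSeries.mk (eulerianNumber k) := by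
  ext i
  rw [Polynomial.coeff_coe, PowerSeries.coeff_mk]
  cases k with
  | zero =>
    rw [eulerianPolynomial, Polynomial.coeff_one]
    cases i <;> simp [eulerianNumber]
  | succ k =>
    rw [eulerianPolynomial, Polynomial.finsetSum_coeff]
    simp only [Polynomial.coeff_C_mul_X_pow]
    rw [Finset.sum_ite_eq]
    split_ifs with h
    · rfl
    · exact (eulerianNumber_eq_zero k.succ_pos (by simpa using h)).symm

/-- The series `∑_m (m + 1)^k q^m`. -/
noncomputable def powerSumSeries (k : ℕ) : PowerSeries ℤ :=
  PowerSeries.mk fun m => ((m : ℤ) + 1) ^ k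

/-- Carlitz' identity `∑_m (m + 1)^k q^m = A_k(q) / (1 - q)^(k + 1)`. -/
theorem powerSumSeries_mul (k : ℕ) :
    powerSumSeries k * (1 - PowerSeries.X) ^ (k + 1) =
      (eulerianPolynomial k : PowerSeries ℤ) := by
  rw [coe_eulerianPolynomial]
  induction k with
  | zero =>
    have h1 : powerSumSeries 0 = PowerSeries.mk 1 := by
      ext n
      simp [powerSumSeries]
    rw [h1, zero_add, pow_one, PowerSeries.mk_one_mul_one_sub_eq_one]
    ext i
    rw [PowerSeries.coeff_one, PowerSeries.coeff_mk]
    cases i <;> simp [eulerianNumber]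
  | succ k ih =>
    -- Differentiate `q G_k(q) (1 - q)^(k + 1) = q A_k(q)`, where `G_(k+1) = (q G_k)'`.
    have hG : powerSumSeries (k + 1) =
        PowerSeries.derivative ℤ (PowerSeries.X * powerSumSeries k) := by
      ext n
      rw [PowerSeries.coeff_derivative, PowerSeries.coeff_succ_X_mul]
      simp only [powerSumSeries, PowerSeries.coeff_mk]
      ring
    have hE : PowerSeries.mk (eulerianNumber (k + 1)) =
        (1 - PowerSeries.X) * PowerSeries.derivative ℤ
          (PowerSeries.X * PowerSeries.mk (eulerianNumber k)) +
        ((k : PowerSeries ℤ) + 1) * (PowerSeries.X * PowerSeries.mk (eulerianNumber k)) := by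
      ext n
      have hk : (k : PowerSeries ℤ) + 1 = PowerSeries.C ((k : ℤ) + 1) := by simp
      rw [hk, map_add, sub_mul, one_mul, map_sub, PowerSeries.coeff_C_mul]
      cases n with
      | zero => simp [eulerianNumber]
      | succ n =>
        simp only [PowerSeries.coeff_derivative, PowerSeries.coeff_succ_X_mul,
          PowerSeries.coeff_mk, eulerianNumber]
        push_cast
        ring
    have hD := congrArg (fun f => PowerSeries.derivative ℤ (PowerSeries.X * f)) ih
    have hP : PowerSeries.derivative ℤ ((1 - PowerSeries.X) ^ (k + 1)) =
        -((k : PowerSeries ℤ) + 1) * (1 - PowerSeries.X) ^ k := by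
      rw [PowerSeries.derivative_pow, map_sub, PowerSeries.derivative_one, PowerSeries.derivative_X]
      push_cast
      ring
    rw [← mul_assoc, Derivation.leibniz, hP, ← hG] at hD
    simp only [smul_eq_mul] at hD
    rw [hE, ← hD]
    linear_combination ((k : PowerSeries ℤ) + 1) * PowerSeries.X * ih

theorem aeval_X_pow_eq_expand {e : ℕ} (he : e ≠ 0) (p : Polynomial ℤ) :
    Polynomial.aeval (PowerSeries.X ^ e : PowerSeries ℤ) p = PowerSeries.expand e he p := by
  have h : Polynomial.aeval (PowerSeries.X ^ e : PowerSeries ℤ) =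
      (PowerSeries.expand e he).comp (Polynomial.coeToPowerSeries.algHom ℤ) := by
    apply Polynomial.algHom_ext
    simp [Polynomial.coeToPowerSeries.algHom_apply]
  rw [h]
  simp [Polynomial.coeToPowerSeries.algHom_apply]

/-! ### The moments -/

/-- The `n`th term of the moment series, with `n = r + 1`, free of denominators. -/
theorem momentTerm_succ {d : ℕ} (hd : d ≠ 0) (k r : ℕ) :
    momentTerm d k (r + 1) = PowerSeries.expand d hd
      ((-1) ^ r * PowerSeries.X ^ ((r ^ 2 + r) / 2 + (r + 1)) * (1 - PowerSeries.X ^ (r + 1)) *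
        PowerSeries.expand (r + 1) r.succ_ne_zero (powerSumSeries k)) := by
  have he : d * (r + 1) ≠ 0 := mul_ne_zero hd r.succ_ne_zero
  have h1 : PowerSeries.constantCoeff
      ((1 - PowerSeries.X ^ (d * (r + 1)) : PowerSeries ℤ) ^ k) = 1 := by
    simp [he]
  have h2 := mul_invOne _ h1
  have h3 := congrArg (PowerSeries.expand (d * (r + 1)) he) (powerSumSeries_mul k)
  rw [momentTerm, aeval_X_pow_eq_expand he, ← h3, triangle_succ]
  simp only [map_mul, map_pow, map_sub, map_neg, map_one, PowerSeries.expand_X,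
    ← PowerSeries.expand_mul, ← pow_mul]
  linear_combination (-1) ^ r * PowerSeries.X ^ (d * ((r ^ 2 + r) / 2 + (r + 1))) *
    PowerSeries.expand (d * (r + 1)) he (powerSumSeries k) *
    (1 - PowerSeries.X ^ (d * (r + 1))) * h2

/-- The double series over the crank `m + 1` and the index `n = r + 1` converges, which justifies
interchanging the sums. -/
theorem summable_pow_mul_crankTerm (k : ℕ) :
    Summable fun p : ℕ × ℕ =>
      PowerSeries.C (((p.1 : ℤ) + 1) ^ k) * crankTerm (p.1 + 1) p.2 := by
  refine summable_of_X_pow_dvd (fun p : ℕ × ℕ => p.1 + p.2) (fun n => ?_) fun p => ?_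
  · refine ((Set.finite_Iic n).prod (Set.finite_Iic n)).subset fun p hp => ?_
    have hp : p.1 + p.2 ≤ n := hp
    exact ⟨Set.mem_Iic.2 (by omega), Set.mem_Iic.2 (by omega)⟩
  · refine dvd_mul_of_dvd_right (dvd_mul_of_dvd_left (dvd_mul_of_dvd_right
      (pow_dvd_pow _ ?_) _) _) _
    nlinarith [Nat.zero_le (p.1 * p.2), Nat.zero_le ((p.2 ^ 2 + p.2) / 2)]

theorem hasSum_pow_mul_crankTerm (k r : ℕ) :
    HasSum (fun m : ℕ => PowerSeries.C (((m : ℤ) + 1) ^ k) * crankTerm (m + 1) r)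
      ((-1) ^ r * PowerSeries.X ^ ((r ^ 2 + r) / 2 + (r + 1)) * (1 - PowerSeries.X ^ (r + 1)) *
        PowerSeries.expand (r + 1) r.succ_ne_zero (powerSumSeries k)) := by
  refine (((PowerSeries.hasSum_of_monomials_self
    (powerSumSeries k)).powerSeries_expand r.succ_ne_zero).mul_left _).congr_fun fun m => ?_
  rw [PowerSeries.expand_monomial, powerSumSeries, PowerSeries.coeff_mk,
    PowerSeries.monomial_eq_C_mul_X_pow, crankTerm, Nat.succ_eq_add_one]
  ring

theorem hasSum_residualCrankPosMoment (d k : ℕ) :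
    HasSum (fun m : ℕ => PowerSeries.C (((m : ℤ) + 1) ^ k) *
        PowerSeries.mk (residualCrankCount d ((m + 1 : ℕ) : ℤ)))
      (PowerSeries.mk fun n => residualCrankPosMoment d k n) := by
  rw [PowerSeries.WithPiTopology.hasSum_iff_hasSum_coeff]
  intro n
  simp only [PowerSeries.coeff_C_mul, PowerSeries.coeff_mk]
  have h : residualCrankPosMoment d k n = ∑ m ∈ Finset.range n,
      ((m : ℤ) + 1) ^ k * residualCrankCount d ((m + 1 : ℕ) : ℤ) n := by
    refine Finset.sum_nbij' (fun m => m - 1) (fun m => m + 1) ?_ ?_ ?_ ?_ ?_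
    · intro m hm
      have := Finset.mem_Icc.1 hm
      exact Finset.mem_range.2 (by omega)
    · intro m hm
      have := Finset.mem_range.1 hm
      exact Finset.mem_Icc.2 (by omega)
    · intro m hm
      have := Finset.mem_Icc.1 hm
      omega
    · intro m _
      omega
    · intro m hm
      have := Finset.mem_Icc.1 hm
      obtain ⟨m, rfl⟩ : ∃ j, m = j + 1 := ⟨m - 1, by omega⟩
      simp
  rw [h]
  refine hasSum_sum_of_ne_finset_zero fun m hm => ?_
  rw [residualCrankCount_eq_zero, mul_zero]
  rw [Nat.abs_cast]
  have : n ≤ m := by simpa using hm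
  omega

/-- Summing the double series over `r` first gives the crank counts. -/
theorem hasSum_tsum_crankTerm {k : ℕ} {U : PowerSeries ℤ}
    (hU : HasSum (fun p : ℕ × ℕ =>
      PowerSeries.C (((p.1 : ℤ) + 1) ^ k) * crankTerm (p.1 + 1) p.2) U) :
    HasSum (fun m : ℕ => PowerSeries.C (((m : ℤ) + 1) ^ k) * ∑' r, crankTerm (m + 1) r) U := by
  have h (m : ℕ) := (hasSum_crankTerm (m + 1)).summable.hasSum.mul_left
    (PowerSeries.C (((m : ℤ) + 1) ^ k))
  exact hU.prod_fiberwise h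

/-- Summing the double series over `m` first gives the terms of the moment series. -/
theorem hasSum_momentTerm {d k : ℕ} (hd : d ≠ 0) {U : PowerSeries ℤ}
    (hU : HasSum (fun p : ℕ × ℕ =>
      PowerSeries.C (((p.1 : ℤ) + 1) ^ k) * crankTerm (p.1 + 1) p.2) U) :
    HasSum (fun n : ℕ+ => momentTerm d k n) (PowerSeries.expand d hd U) := by
  have hswap : HasSum (fun p : ℕ × ℕ =>
      PowerSeries.C (((p.2 : ℤ) + 1) ^ k) * crankTerm (p.2 + 1) p.1) U :=
    (Equiv.prodComm ℕ ℕ).hasSum_iff.2 hU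
  have hcol := (hswap.prod_fiberwise fun r => hasSum_pow_mul_crankTerm k r).powerSeries_expand hd
  simp only [← momentTerm_succ] at hcol
  exact Equiv.pnatEquivNat.symm.hasSum_iff.1 hcol

theorem lemma2 (d k : ℕ) (hd : 1 ≤ d) :
    Summable (fun n : ℕ+ => momentTerm d k n) ∧
    PowerSeries.mk (fun n : ℕ => residualCrankPosMoment d k n) =
      overpartitionSeries * ∑' n : ℕ+, momentTerm d k n := by
  have hd0 : d ≠ 0 := by omega
  have hU := (summable_pow_mul_crankTerm k).hasSum
  have hmoment := hasSum_momentTerm hd0 hU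
  refine ⟨hmoment.summable, ?_⟩
  rw [hmoment.tsum_eq]
  have h := ((hasSum_tsum_crankTerm hU).powerSeries_expand hd0).mul_left overpartitionSeries
  refine (hasSum_residualCrankPosMoment d k).unique (h.congr_fun fun m => ?_)
  rw [mk_residualCrankCount hd0 m.succ_pos, map_mul, PowerSeries.expand_C]
  ring
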